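/- All spaces are Tychonoff (completely regular and $T_1$). In the open-open game on a non-empty space $X$, two players play countably many rounds $n=0,1,2,\dots$; in round $n$ player I chooses a non-empty open set $V_n\subseteq X$ and then player II chooses a non-empty open set $U_n\subseteq V_n$. Player I wins if $\bigcup_{n\ge 0}U_n$ is dense in $X$; otherwise player II wins. The space $X$ is called $\mathrm I$-favorable if player I has a winning strategy, that is, if there is a function $\sigma$ assigning to every finite (possibly empty) sequence of non-empty open subsets of $X$ a non-empty open subset of $X$ such that $\bigcup_{n\ge 0}U_n$ is dense in $X$ for every sequence $(U_n)_{n\ge 0}$ of non-empty open subsets of $X$ with $U_0\subseteq\sigma(\varnothing)$ and $U_{n+1}\subseteq\sigma(U_0,\dots,U_n)$ for all $n\ge 0$. Corollary 1.3. If $X$ is an $\mathrm I$-favorable Tychonoff space and $W\subseteq X$ is a non-empty open subset, then $W$, with the subspace topology, is $\mathrm I$-favorable. -/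

import Mathlib

open TopologicalSpace

/-- The possible moves in the open-open game on `X`: the non-empty open subsets of `X`. -/
abbrev OpenMove (X : Type*) [TopologicalSpace X] : Type _ :=
  {U : Opens X // (U : Set X).Nonempty}

/-- A strategy of player I in the open-open game: it assigns to every finite sequence
`(U₀, …, Uₙ₋₁)` of moves of player II (the empty sequence included) a move of player I. -/
abbrev OpenOpenStrategy (X : Type*) [TopologicalSpace X] : Type _ :=
  (n : ℕ) → (Fin n → OpenMove X) → OpenMove X

/-- The strategy `σ` of player I is winning: the union of the moves of player II is dense in
every game `(σ(∅), U₀, σ(U₀), U₁, σ(U₀, U₁), U₂, …)` in which player II obeys the rules, i.e.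
`U₀ ⊆ σ(∅)` and `Uₙ₊₁ ⊆ σ(U₀, …, Uₙ)` for every `n`. -/
def OpenOpenStrategy.IsWinning {X : Type*} [TopologicalSpace X]
    (σ : OpenOpenStrategy X) : Prop :=
  ∀ U : ℕ → OpenMove X,
    (∀ n : ℕ, ((U n).1 : Set X) ⊆ ((σ n (fun i : Fin n => U i)).1 : Set X)) →
      Dense (⋃ n : ℕ, ((U n).1 : Set X))

/-- A space is I-favorable if player I has a winning strategy in the open-open game. -/
def IFavorable (X : Type*) [TopologicalSpace X] : Prop :=
  ∃ σ : OpenOpenStrategy X, σ.IsWinning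

/-! Player I in `W` runs a parallel game in `X` under `σ`. A move of `σ` meeting `W` is traced on
`W` and the answer passed back; a move missing `W` is answered by itself in `X`, whatever is played
in `W`. The play in `X` is legal (`reply_subset`), so its union is dense, and points of it in `W`
come from answers in `W` (`reply_inter_subset`). -/

namespace OpenMove

variable {X : Type*} [TopologicalSpace X] {W : Set X}

/-- The move in the open subspace `W` that player I copies from the move `V` in `X`: the trace of
`V` on `W` when it is non-empty, and all of `W` otherwise. -/
noncomputable def restrict (hne : W.Nonempty) (V : OpenMove X) : OpenMove W := by
  classical
  exact if h : ((V.1 : Set X) ∩ W).Nonempty then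
    ⟨⟨((↑) : W → X) ⁻¹' V.1, V.1.isOpen.preimage continuous_subtype_val⟩,
      h.elim fun x hx => ⟨⟨x, hx.2⟩, hx.1⟩⟩
  else ⟨⊤, hne.elim fun x hx => ⟨⟨x, hx⟩, trivial⟩⟩

/-- The answer in `X` to the move `V` of player I that corresponds to the answer `U` in `W` to
`restrict V`: it is `U` if `V` meets `W`, and `V` itself otherwise. -/
noncomputable def reply (hW : IsOpen W) (V : OpenMove X) (U : OpenMove W) : OpenMove X := by
  classical
  exact if ((V.1 : Set X) ∩ W).Nonempty then
    ⟨⟨((↑) : W → X) '' U.1, hW.isOpenMap_subtype_val _ U.1.isOpen⟩, U.2.image _⟩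
  else V

theorem reply_subset (hW : IsOpen W) (hne : W.Nonempty) {V : OpenMove X} {U : OpenMove W}
    (h : (U.1 : Set W) ⊆ (restrict hne V).1) : ((reply hW V U).1 : Set X) ⊆ V.1 := by
  by_cases hV : ((V.1 : Set X) ∩ W).Nonempty
  · simp only [restrict, hV, dite_true] at h
    simp only [reply, hV, if_true]
    exact Set.image_subset_iff.2 h
  · simp only [reply, hV, if_false, subset_refl]

theorem reply_inter_subset (hW : IsOpen W) (V : OpenMove X) (U : OpenMove W) :
    ((reply hW V U).1 : Set X) ∩ W ⊆ ((↑) : W → X) '' U.1 := by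
  by_cases hV : ((V.1 : Set X) ∩ W).Nonempty
  · simp only [reply, hV, if_true]
    exact Set.inter_subset_left
  · simp only [reply, hV, if_false]
    exact fun x hx => (hV ⟨x, hx⟩).elim

end OpenMove

namespace OpenOpenStrategy

variable {X : Type*} [TopologicalSpace X] {W : Set X}

/-- The answers of player II in `X` against `σ` that correspond to given answers in `W`. -/
noncomputable def lift (σ : OpenOpenStrategy X) (hW : IsOpen W) :
    (n : ℕ) → (Fin n → OpenMove W) → Fin n → OpenMove X
  | 0, _ => Fin.elim0
  | n + 1, v =>
    Fin.snoc (α := fun _ => OpenMove X) (lift σ hW n (Fin.init v))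
      (OpenMove.reply hW (σ n (lift σ hW n (Fin.init v))) (v (Fin.last n)))

/-- The strategy on an open subspace `W` that follows the strategy `σ` in a parallel game on the
whole space. -/
noncomputable def restrict (σ : OpenOpenStrategy X) (hW : IsOpen W) (hne : W.Nonempty) :
    OpenOpenStrategy W :=
  fun n v => OpenMove.restrict hne (σ n (σ.lift hW n v))

/-- The infinite sequence of answers in `X` that corresponds to a sequence of answers in `W`. -/
noncomputable def liftSeq (σ : OpenOpenStrategy X) (hW : IsOpen W) (U : ℕ → OpenMove W) (n : ℕ) :
    OpenMove X :=
  OpenMove.reply hW (σ n (σ.lift hW n fun i => U i)) (U n)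

/-- Lifting an answer uses only earlier answers, so the finite lifts cohere into one infinite play,
to which `σ.IsWinning` applies. -/
theorem lift_eq_liftSeq (σ : OpenOpenStrategy X) (hW : IsOpen W) (U : ℕ → OpenMove W) (n : ℕ) :
    σ.lift hW n (fun i => U i) = fun i : Fin n => σ.liftSeq hW U i := by
  induction n with
  | zero => exact funext fun i => i.elim0
  | succ n ih =>
    funext i
    refine Fin.lastCases ?_ (fun j => ?_) i
    · simp only [lift, Fin.snoc_last]
      rfl
    · simp only [lift, Fin.snoc_castSucc]
      exact congrFun ih j

theorem IsWinning.restrict {σ : OpenOpenStrategy X} (hσ : σ.IsWinning) (hW : IsOpen W)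
    (hne : W.Nonempty) : (σ.restrict hW hne).IsWinning := by
  intro U hU
  have hdense : Dense (⋃ n, ((σ.liftSeq hW U n).1 : Set X)) := by
    refine hσ _ fun n => ?_
    rw [← lift_eq_liftSeq]
    exact OpenMove.reply_subset hW hne (hU n)
  rw [dense_iff_inter_open]
  intro O hO hOne
  -- As `W` is open, `O` is also open in `X`, where density is known.
  obtain ⟨_, ⟨w, hwO, rfl⟩, hw⟩ :=
    hdense.inter_open_nonempty _ (hW.isOpenMap_subtype_val O hO) (hOne.image _)
  obtain ⟨n, hn⟩ := Set.mem_iUnion.1 hw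
  obtain ⟨w', hw', h⟩ := OpenMove.reply_inter_subset hW _ _ ⟨hn, w.2⟩
  obtain rfl := Subtype.ext h
  exact ⟨w', hwO, Set.mem_iUnion.2 ⟨n, hw'⟩⟩

end OpenOpenStrategy

theorem corollary1p3 {X : Type*} [TopologicalSpace X] [T35Space X] (hX : IFavorable X)
    (W : Set X) (hW : IsOpen W) (hne : W.Nonempty) : IFavorable W := by
  obtain ⟨σ, hσ⟩ := hX
  exact ⟨σ.restrict hW hne, hσ.restrict hW hne⟩
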